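/- **Conventions.** Let $ID(\mathbb R)$ be the set of infinitely divisible probability measures on $\mathbb R$, and $ID(\mathbb R^+)$ the set of those that are concentrated on $[0,\infty)$ (the laws of subordinators at time $1$). For $\mu\in ID(\mathbb R)$ let $\phi=\log\widehat\mu$ be its characteristic exponent (the continuous function with $\phi(0)=0$ and $\widehat\mu=e^{\phi}$), and for $s\ge 0$ let $\mu^s$ be the probability measure with characteristic function $e^{s\phi}$. For a measure $\rho$ on $\mathbb R$ concentrated on $[0,\infty)$ put $$\Phi_\mu(\rho)(A)=\int_{(0,\infty)}\mu^s(A)\,\rho(ds)\quad (A\subseteq\mathbb R\setminus\{0\}\text{ Borel}),\qquad \Phi_\mu(\rho)(\{0\})=0 .$$ A Lévy measure is a Borel measure $\rho$ on $\mathbb R$ with $\rho(\{0\})=0$ and $\int(1\wedge x^2)\,\rho(dx)<\infty$, and $\mathfrak M_L^1(\mathbb R^+)$ is the set of Lévy measures $\rho$ concentrated on $(0,\infty)$ with $\int_0^\infty(1\wedge x)\,\rho(dx)<\infty$. A law $\eta$ has Lévy measure $\rho$ if, for some $\gamma\in\mathbb R$ and $b\ge0$, $\log\widehat\eta(z)=i\gamma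 z-\tfrac12 bz^2+\int\big(e^{izx}-1-izx\mathbf 1_{\{|x|\le1\}}\big)\rho(dx)$ for all $z\in\mathbb R$. **Proposition.** Let $\mu\in ID(\mathbb R)$ be either symmetric or concentrated on $[0,\infty)$ (in particular, $\mu$ may be supported on $(0,\infty)$), and let $\rho,\widetilde\rho\in\mathfrak M_L^1(\mathbb R^+)$. Then $\Phi_\mu(\rho)=\Phi_\mu(\widetilde\rho)$ if and only if there exist $\eta_\rho,\eta_{\widetilde\rho}\in ID(\mathbb R^+)$, with Lévy measures $\rho$ and $\widetilde\rho$ respectively, such that $\Phi_\mu(\eta_\rho)=\Phi_\mu(\eta_{\widetilde\rho})$. Moreover, these laws are not unique: if $\Phi_\mu(\rho)=\Phi_\mu(\widetilde\rho)$, then there are two such pairs $(\eta_\rho,\eta_{\widetilde\rho})$ and $(\eta'_\rho,\eta'_{\widetilde\rho})$ with $\eta_\rho\neq\eta'_\rho$ and $\eta_{\widetilde\rho}\neq\eta'_{\widetilde\rho}$, and all four laws can be chosen concentrated on $(0,\infty)$. -/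

import Mathlib

open MeasureTheory Set

noncomputable section

/-- The `n`-fold convolution of a measure on `ℝ` with itself. -/
def convIter (ν : Measure ℝ) : ℕ → Measure ℝ
  | 0 => Measure.dirac 0
  | n + 1 => (convIter ν n).conv ν

/-- `μ ∈ ID(ℝ)`: an infinitely divisible probability measure on `ℝ`. -/
def IsInfDiv (μ : Measure ℝ) : Prop :=
  IsProbabilityMeasure μ ∧
    ∀ n : ℕ, 0 < n → ∃ ν : Measure ℝ, IsProbabilityMeasure ν ∧ convIter ν n = μ

/-- `μ ∈ ID(ℝ⁺)`: an infinitely divisible law carried by the non-negative half-line,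
i.e. the law of a subordinator at time `1`. -/
def IsInfDivNonneg (μ : Measure ℝ) : Prop :=
  IsInfDiv μ ∧ μ (Iio 0) = 0

/-- `ρ ∈ 𝔐_L(ℝ)`: a Lévy measure on `ℝ`. -/
def IsLevyMeasure (ρ : Measure ℝ) : Prop :=
  ρ {0} = 0 ∧ ∫⁻ x, ENNReal.ofReal (min 1 (|x| ^ 2)) ∂ρ < ⊤

/-- `ρ ∈ 𝔐_L¹(ℝ⁺)`: a Lévy measure carried by `(0, ∞)` that integrates `1 ∧ x`. -/
def IsLevyMeasureOne (ρ : Measure ℝ) : Prop :=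
  IsLevyMeasure ρ ∧ ρ (Iio 0) = 0 ∧ ∫⁻ x, ENNReal.ofReal (min 1 |x|) ∂ρ < ⊤

/-- The truncation function `τ(x) = x 1_{|x| ≤ 1}`. -/
def trunc (x : ℝ) : ℝ := if |x| ≤ 1 then x else 0

/-- `η` has a Lévy-Khintchine representation with characteristic triplet `(γ, b, ρ)`,
relative to the truncation function `τ`. -/
def HasTriplet (η : Measure ℝ) (γ b : ℝ) (ρ : Measure ℝ) : Prop :=
  0 ≤ b ∧ IsLevyMeasure ρ ∧ ∀ z : ℝ,
    charFun η z = Complex.exp (Complex.I * z * γ - (1 / 2) * (z : ℂ) ^ 2 * b +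
      ∫ x, (Complex.exp (Complex.I * z * x) - 1 - Complex.I * trunc x * z) ∂ρ)

/-- `ρ` is the Lévy measure of `η`. -/
def HasLevyMeasure (η ρ : Measure ℝ) : Prop := ∃ γ b : ℝ, HasTriplet η γ b ρ

/-- `φ` is the characteristic exponent `log μ̂` (distinguished logarithm) of `μ`. -/
def IsCharExponent (μ : Measure ℝ) (φ : ℝ → ℂ) : Prop :=
  Continuous φ ∧ φ 0 = 0 ∧ ∀ θ : ℝ, charFun μ θ = Complex.exp (φ θ)

open Classical in
/-- The convolution power `μ^s`: the probability measure with characteristic function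
`θ ↦ exp (s φ(θ))`, where `φ` is the characteristic exponent of `μ`. It exists for all `s ≥ 0`
when `μ` is infinitely divisible; the value `0` is used if there is no such measure. -/
def convPow (μ : Measure ℝ) (s : ℝ) : Measure ℝ :=
  if h : ∃ ν : Measure ℝ, IsProbabilityMeasure ν ∧
      ∃ φ : ℝ → ℂ, IsCharExponent μ φ ∧ ∀ θ : ℝ, charFun ν θ = Complex.exp (s * φ θ)
  then h.choose else 0

/-- The Lévy mixing map `Φ_μ(ρ)(A) = ∫_0^∞ μ^s(A) ρ(ds)` for Borel `A ⊆ ℝ \ {0}`, and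
`Φ_μ(ρ)({0}) = 0`. -/
def levyMix (μ ρ : Measure ℝ) : Measure ℝ :=
  ((ρ.restrict (Ioi 0)).bind (convPow μ)).restrict {0}ᶜ

/-- The pairs `(η, η')` of laws in `ID(ℝ⁺)` with Lévy measures `ρ` and `ρ'` such that
`Φ_μ(η) = Φ_μ(η')`. -/
def matchingPairs (μ ρ ρ' : Measure ℝ) : Set (Measure ℝ × Measure ℝ) :=
  {p | IsInfDivNonneg p.1 ∧ IsInfDivNonneg p.2 ∧
    HasLevyMeasure p.1 ρ ∧ HasLevyMeasure p.2 ρ' ∧ levyMix μ p.1 = levyMix μ p.2}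

end

open Filter Topology ProbabilityTheory

/-! If `μ` is the point mass at `0`, every mixture is zero and there is nothing to match. Otherwise
the mixing map is injective on measures on `(0, ∞)` that integrate `1 ∧ x`, so both sides of the
equivalence say `ρ = ρ'`. Given `ρ = ρ'`, one takes a common subordinator law with positive drift;
drifts `1` and `2` give two different pairs. Conversely, laws `η`, `η'` with the same mixture agree
on `(0, ∞)`, hence everywhere because both have mass one on `[0, ∞)`, and a law determines its Lévy
measure (`HasLevyMeasure.unique`).

Injectivity (`IsInfDiv.restrict_eq_of_levyMix_eq`) rests on test functions that vanish at `0`: `1 -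
exp (-l x)` for `μ` on the half-line, `1 - cos (θ x)` for symmetric `μ`. Their integrals against
`μ^s` are `1 - exp (-s u)`, where `u` fills an interval `(0, u₀]`. The mixture thus determines the
Bernstein function `u ↦ ∫ (1 - exp (-s u)) m(ds)` near `0`. Differencing turns it into the Laplace
transform of a finite measure, and analytic continuation recovers `m`. -/

/-! ### Convolution iterates and Lévy's continuity theorem. -/

theorem isProbabilityMeasure_convIter (ν : Measure ℝ) [IsProbabilityMeasure ν] (n : ℕ) :
    IsProbabilityMeasure (convIter ν n) := by
  induction n with
  | zero => rw [convIter]; infer_instance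
  | succ n ih => rw [convIter]; infer_instance

theorem charFun_convIter (ν : Measure ℝ) [IsProbabilityMeasure ν] (n : ℕ) (t : ℝ) :
    charFun (convIter ν n) t = charFun ν t ^ n := by
  induction n with
  | zero => simp [convIter]
  | succ n ih =>
    have := isProbabilityMeasure_convIter ν n
    rw [convIter, charFun_conv, ih, pow_succ]

/-- Continuity of `g` at `0` gives tightness, Prokhorov's theorem gives a cluster point along an
ultrafilter, and its characteristic function must be `g`. -/
theorem exists_tendsto_of_tendsto_charFun {μ : ℕ → ProbabilityMeasure ℝ} {g : ℝ → ℂ}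
    (hg : ContinuousAt g 0)
    (h : ∀ t, Tendsto (fun n => charFun (μ n : Measure ℝ) t) atTop (𝓝 (g t))) :
    ∃ ν : ProbabilityMeasure ℝ, (∀ t, charFun (ν : Measure ℝ) t = g t) ∧
      Tendsto μ atTop (𝓝 ν) := by
  have ht : IsTightMeasureSet (range fun n => (μ n : Measure ℝ)) :=
    isTightMeasureSet_of_tendsto_charFun hg h
  have hc : IsCompact (closure (range μ)) := by
    apply isCompact_closure_of_isTightMeasureSet
    convert ht using 1
    ext; simp
  obtain ⟨ν, -, hν⟩ := hc.ultrafilter_le_nhds ((hyperfilter ℕ).map μ)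
    (.trans (by simp) (monotone_principal subset_closure))
  have hν' : Tendsto μ (hyperfilter ℕ) (𝓝 ν) := hν
  have hle : (hyperfilter ℕ : Filter ℕ) ≤ atTop := by
    rw [← Nat.cofinite_eq_atTop]; exact hyperfilter_le_cofinite
  have hch : ∀ t, charFun (ν : Measure ℝ) t = g t := by
    intro t
    rw [ProbabilityMeasure.tendsto_iff_forall_integral_rclike_tendsto ℂ] at hν'
    refine tendsto_nhds_unique ?_ ((h t).mono_left hle)
    simp_rw [charFun_eq_integral_innerProbChar]
    exact hν' _
  exact ⟨ν, hch, ProbabilityMeasure.tendsto_of_tendsto_charFun (by simpa only [hch] using h)⟩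

/-! ### Infinitely divisible laws have non-vanishing characteristic functions. -/

theorem integrable_cos_mul (P : Measure ℝ) [IsFiniteMeasure P] (t : ℝ) :
    Integrable (fun x => Real.cos (t * x)) P :=
  (integrable_const (1 : ℝ)).mono' (by fun_prop)
    (.of_forall fun x => by simpa using Real.abs_cos_le_one _)

theorem re_charFun (P : Measure ℝ) [IsFiniteMeasure P] (t : ℝ) :
    (charFun P t).re = ∫ x, Real.cos (t * x) ∂P := by
  rw [charFun_apply_real]
  have hi : Integrable (fun x : ℝ => Complex.exp (t * x * Complex.I)) P := by
    refine (integrable_const (1 : ℝ)).mono' (by fun_prop) (.of_forall fun x => ?_)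
    rw [← Complex.ofReal_mul, Complex.norm_exp_ofReal_mul_I]
  have := integral_re hi
  simp only [RCLike.re_eq_complex_re] at this
  rw [← this]
  congr with x
  rw [← Complex.ofReal_mul, Complex.exp_ofReal_mul_I_re]

theorem one_sub_re_charFun (P : Measure ℝ) [IsProbabilityMeasure P] (t : ℝ) :
    1 - (charFun P t).re = ∫ x, (1 - Real.cos (t * x)) ∂P := by
  rw [re_charFun, integral_sub (integrable_const _) (integrable_cos_mul P t)]
  simp

theorem one_sub_re_charFun_two_mul_le (P : Measure ℝ) [IsProbabilityMeasure P] (t : ℝ) :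
    1 - (charFun P (2 * t)).re ≤ 4 * (1 - (charFun P t).re) := by
  rw [one_sub_re_charFun, one_sub_re_charFun, ← integral_const_mul]
  refine integral_mono ((integrable_const _).sub (integrable_cos_mul P _))
    (((integrable_const _).sub (integrable_cos_mul P _)).const_mul _) fun x => ?_
  have : 2 * t * x = 2 * (t * x) := by ring
  simp only [this, Real.cos_two_mul]
  nlinarith [sq_nonneg (1 - Real.cos (t * x))]

theorem charFun_map_neg (P : Measure ℝ) (t : ℝ) :
    charFun (P.map (fun x => -x)) t = charFun P (-t) := by
  have := charFun_map_mul (μ := P) (-1) t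
  simpa using this

/-- The squared modulus is the characteristic function of the symmetrised law, to which the doubling
inequality `1 - cos 2y ≤ 4 (1 - cos y)` applies. -/
theorem one_sub_norm_sq_charFun_two_mul_le (P : Measure ℝ) [IsProbabilityMeasure P] (t : ℝ) :
    1 - ‖charFun P (2 * t)‖ ^ 2 ≤ 4 * (1 - ‖charFun P t‖ ^ 2) := by
  have : IsProbabilityMeasure (P.map (fun x => -x)) :=
    Measure.isProbabilityMeasure_map (by fun_prop)
  have key : ∀ t, (charFun (P.conv (P.map (fun x => -x))) t).re = ‖charFun P t‖ ^ 2 := by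
    intro t
    rw [charFun_conv, charFun_map_neg, charFun_neg, Complex.mul_conj, Complex.ofReal_re,
      Complex.normSq_eq_norm_sq]
  simpa only [key] using one_sub_re_charFun_two_mul_le (P.conv (P.map (fun x => -x))) t

theorem IsInfDiv.exists_root {μ : Measure ℝ} (hμ : IsInfDiv μ) {n : ℕ} (hn : 0 < n) :
    ∃ ν : Measure ℝ, IsProbabilityMeasure ν ∧ convIter ν n = μ ∧
      ∀ t, charFun ν t ^ n = charFun μ t := by
  obtain ⟨ν, h1, h2⟩ := hμ.2 n hn
  exact ⟨ν, h1, h2, fun t => by rw [← h2, charFun_convIter]⟩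

/-- At `t`, the squared modulus for an `n`-th root tends to `1`, so it exceeds `3/4` for some `n`; a
zero at `2 * t` would then contradict the doubling inequality. Iterating from a point near `0`
reaches every `t`. -/
theorem IsInfDiv.charFun_two_mul_ne_zero {μ : Measure ℝ} (hμ : IsInfDiv μ) {t : ℝ}
    (ht : charFun μ t ≠ 0) : charFun μ (2 * t) ≠ 0 := by
  have hlim : Tendsto (fun n : ℕ => (‖charFun μ t‖ ^ ((1 : ℝ) / n)) ^ 2) atTop (𝓝 1) := by
    have h1 : Tendsto (fun n : ℕ => ‖charFun μ t‖ ^ ((1 : ℝ) / n)) atTop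
        (𝓝 (‖charFun μ t‖ ^ (0 : ℝ))) :=
      (Real.continuousAt_const_rpow (norm_ne_zero_iff.2 ht)).tendsto.comp
        tendsto_one_div_atTop_nhds_zero_nat
    simpa using h1.pow 2
  obtain ⟨n, hn, hn0⟩ := ((hlim.eventually (lt_mem_nhds (show (3 / 4 : ℝ) < 1 by norm_num))).and
    (eventually_gt_atTop 0)).exists
  obtain ⟨ν, hν, -, hch⟩ := hμ.exists_root hn0
  have h1 : ‖charFun ν t‖ = ‖charFun μ t‖ ^ ((1 : ℝ) / n) := by
    rw [← hch t, norm_pow, one_div, Real.pow_rpow_inv_natCast (norm_nonneg _) hn0.ne']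
  have h2 := one_sub_norm_sq_charFun_two_mul_le ν t
  rw [h1] at h2
  rw [← hch]
  refine pow_ne_zero _ fun h => ?_
  rw [h] at h2
  norm_num at h2
  norm_num at hn
  linarith

theorem IsInfDiv.charFun_ne_zero {μ : Measure ℝ} (hμ : IsInfDiv μ) (t : ℝ) :
    charFun μ t ≠ 0 := by
  have := hμ.1
  have hlim : Tendsto (fun k : ℕ => charFun μ (t / 2 ^ k)) atTop (𝓝 1) := by
    have h0 : Tendsto (fun k : ℕ => t / 2 ^ k) atTop (𝓝 0) :=
      tendsto_const_nhds.div_atTop (tendsto_pow_atTop_atTop_of_one_lt (by norm_num))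
    have := ((continuous_charFun (μ := μ)).tendsto 0).comp h0
    simpa [Function.comp_def] using this
  obtain ⟨k, hk⟩ := (hlim.eventually_ne one_ne_zero).exists
  have : ∀ j ≤ k, charFun μ (t / 2 ^ (k - j)) ≠ 0 := by
    intro j hj
    induction j with
    | zero => exact hk
    | succ j ih =>
      have h := hμ.charFun_two_mul_ne_zero (ih (by omega))
      have e : k - j = (k - (j + 1)) + 1 := by omega
      rw [e, pow_succ] at h
      convert h using 2
      field_simp
  simpa using this k le_rfl

/-! ### Characteristic exponents and roots. -/

theorem existsUnique_continuous_log {f : ℝ → ℂ} (hf : Continuous f) (h0 : f 0 = 1)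
    (hne : ∀ t, f t ≠ 0) :
    ∃ φ : ℝ → ℂ, (Continuous φ ∧ φ 0 = 0 ∧ ∀ t, f t = Complex.exp (φ t)) ∧
      ∀ φ' : ℝ → ℂ, Continuous φ' → φ' 0 = 0 → (∀ t, f t = Complex.exp (φ' t)) → φ' = φ := by
  obtain ⟨F, ⟨hF0, hF⟩, hu⟩ := Complex.isCoveringMapOn_exp.existsUnique_continuousMap_lifts
    (⟨f, hf⟩ : C(ℝ, ℂ)) (a₀ := 0) (e₀ := 0) (by simp [h0]) (by simpa using hne)
  refine ⟨F, ⟨F.continuous, hF0, fun t => (congrFun hF t).symm⟩, fun φ' h1 h2 h3 => ?_⟩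
  have := hu ⟨φ', h1⟩ ⟨h2, funext fun t => (h3 t).symm⟩
  rw [← this]; rfl

theorem eq_of_exp_eq {φ φ' : ℝ → ℂ} (h : Continuous φ) (h' : Continuous φ') (h0 : φ 0 = 0)
    (h0' : φ' 0 = 0) (he : ∀ t, Complex.exp (φ t) = Complex.exp (φ' t)) : φ = φ' := by
  obtain ⟨ψ, -, hψ⟩ := existsUnique_continuous_log (f := fun t => Complex.exp (φ t))
    (by fun_prop) (by simp [h0]) (fun t => Complex.exp_ne_zero _)
  rw [hψ φ h h0 fun _ => rfl, hψ φ' h' h0' he]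

theorem IsInfDiv.exists_isCharExponent {μ : Measure ℝ} (hμ : IsInfDiv μ) :
    ∃ φ, IsCharExponent μ φ := by
  have := hμ.1
  obtain ⟨φ, h, -⟩ := existsUnique_continuous_log (f := charFun μ) continuous_charFun (by simp)
    hμ.charFun_ne_zero
  exact ⟨φ, h⟩

theorem IsCharExponent.unique {μ : Measure ℝ} {φ φ' : ℝ → ℂ} (h : IsCharExponent μ φ)
    (h' : IsCharExponent μ φ') : φ = φ' :=
  eq_of_exp_eq h.1 h'.1 h.2.1 h'.2.1 fun t => by rw [← h.2.2, h'.2.2]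

/-- `n` times the continuous logarithm of the root is a continuous logarithm of `charFun μ`
vanishing at `0`, hence equals `φ`; this excludes a root-of-unity factor. -/
theorem IsCharExponent.charFun_root {μ ν : Measure ℝ} [IsProbabilityMeasure ν] {φ : ℝ → ℂ}
    (hμ : IsInfDiv μ) (hφ : IsCharExponent μ φ) {n : ℕ} (hn : 0 < n)
    (hν : convIter ν n = μ) (t : ℝ) : charFun ν t = Complex.exp (φ t / n) := by
  have hpow : ∀ t, charFun ν t ^ n = charFun μ t := fun t => by rw [← hν, charFun_convIter]
  have hne : ∀ t, charFun ν t ≠ 0 := fun t h => hμ.charFun_ne_zero t (by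
    rw [← hpow, h, zero_pow hn.ne'])
  obtain ⟨ψ, ⟨h1, h2, h3⟩, -⟩ := existsUnique_continuous_log (f := charFun ν) continuous_charFun
    (by simp) hne
  have hn' : (n : ℂ) ≠ 0 := by exact_mod_cast hn.ne'
  have : (fun t => n * ψ t) = φ := by
    refine eq_of_exp_eq (by fun_prop) hφ.1 (by simp [h2]) hφ.2.1 fun t => ?_
    rw [Complex.exp_nat_mul, ← h3, hpow, hφ.2.2]
  rw [h3, ← this]
  field_simp

/-! ### Convolution powers and the mixing map. -/

theorem convPow_eq_of_charFun {μ P : Measure ℝ} [hP : IsProbabilityMeasure P] {φ : ℝ → ℂ}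
    (hφ : IsCharExponent μ φ) {s : ℝ} (h : ∀ θ, charFun P θ = Complex.exp (s * φ θ)) :
    convPow μ s = P := by
  have hex : ∃ ν : Measure ℝ, IsProbabilityMeasure ν ∧
      ∃ φ : ℝ → ℂ, IsCharExponent μ φ ∧ ∀ θ : ℝ, charFun ν θ = Complex.exp (s * φ θ) :=
    ⟨P, hP, φ, hφ, h⟩
  rw [convPow, dif_pos hex]
  obtain ⟨h1, φ', hφ', h2⟩ := hex.choose_spec
  refine Measure.ext_of_charFun (funext fun θ => ?_)
  rw [h2, h, hφ'.unique hφ]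

/-- The convolution power `μ^s` is the weak limit of convolution powers of roots of `μ`. -/
theorem IsInfDiv.exists_tendsto_convPow {μ : Measure ℝ} {φ : ℝ → ℂ} (hμ : IsInfDiv μ)
    (hφ : IsCharExponent μ φ) {s : ℝ} (hs : 0 ≤ s) :
    ∃ (P : ProbabilityMeasure ℝ) (p : ℕ → ℕ) (ν : ℕ → Measure ℝ) (μs : ℕ → ProbabilityMeasure ℝ),
      (P : Measure ℝ) = convPow μ s ∧ (∀ θ, charFun (P : Measure ℝ) θ = Complex.exp (s * φ θ)) ∧
      (∀ k, IsProbabilityMeasure (ν k) ∧ convIter (ν k) (k + 1) = μ ∧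
        (μs k : Measure ℝ) = convIter (ν k) (p k)) ∧
      Tendsto (fun k => (p k : ℝ) / ((k + 1 : ℕ) : ℝ)) atTop (𝓝 s) ∧ Tendsto μs atTop (𝓝 P) := by
  choose ν hν1 hν2 using fun k : ℕ => hμ.2 (k + 1) k.succ_pos
  -- The `p k`-th power of a `(k + 1)`-th root approximates `μ^s`, since `p k / (k + 1)` tends to
  -- `s`.
  let p : ℕ → ℕ := fun k => ⌊s * ((k + 1 : ℕ) : ℝ)⌋₊
  have hp : Tendsto (fun k => (p k : ℝ) / ((k + 1 : ℕ) : ℝ)) atTop (𝓝 s) :=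
    ((tendsto_nat_floor_mul_div_atTop hs).comp tendsto_natCast_atTop_atTop).comp
      (tendsto_add_atTop_nat 1)
  let μs : ℕ → ProbabilityMeasure ℝ :=
    fun k => ⟨convIter (ν k) (p k), isProbabilityMeasure_convIter _ _⟩
  have hch : ∀ t, Tendsto (fun k => charFun (μs k : Measure ℝ) t) atTop
      (𝓝 (Complex.exp (s * φ t))) := by
    intro t
    have : ∀ k, charFun (μs k : Measure ℝ) t =
        Complex.exp (((p k : ℝ) / ((k + 1 : ℕ) : ℝ) : ℝ) * φ t) := by
      intro k
      change charFun (convIter (ν k) (p k)) t = _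
      rw [charFun_convIter, hφ.charFun_root hμ k.succ_pos (hν2 k), ← Complex.exp_nat_mul]
      congr 1
      push_cast
      ring
    simp_rw [this]
    have hc : Continuous fun r : ℝ => Complex.exp (r * φ t) := by fun_prop
    exact (hc.tendsto s).comp hp
  obtain ⟨P, hP1, hP2⟩ := exists_tendsto_of_tendsto_charFun
    (g := fun t => Complex.exp (s * φ t)) (by have := hφ.1; fun_prop) hch
  exact ⟨P, p, ν, μs, (convPow_eq_of_charFun hφ hP1).symm, hP1,
    fun k => ⟨hν1 k, hν2 k, rfl⟩, hp, hP2⟩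

theorem IsInfDiv.isProbabilityMeasure_convPow {μ : Measure ℝ} (hμ : IsInfDiv μ) {s : ℝ}
    (hs : 0 ≤ s) : IsProbabilityMeasure (convPow μ s) := by
  obtain ⟨φ, hφ⟩ := hμ.exists_isCharExponent
  obtain ⟨P, -, -, -, h, -⟩ := hμ.exists_tendsto_convPow hφ hs
  rw [← h]; infer_instance

theorem IsInfDiv.charFun_convPow {μ : Measure ℝ} {φ : ℝ → ℂ} (hμ : IsInfDiv μ)
    (hφ : IsCharExponent μ φ) {s : ℝ} (hs : 0 ≤ s) (θ : ℝ) :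
    charFun (convPow μ s) θ = Complex.exp (s * φ θ) := by
  obtain ⟨P, -, -, -, h, h', -⟩ := hμ.exists_tendsto_convPow hφ hs
  rw [← h, h']

/-- The indicator of a closed set is a limit of bounded continuous functions, whose integrals depend
continuously on `x`. -/
theorem measurable_toMeasure_of_continuous {X : Type*} [TopologicalSpace X] [MeasurableSpace X]
    [OpensMeasurableSpace X] {f : X → ProbabilityMeasure ℝ} (hf : Continuous f) :
    Measurable fun x => (f x : Measure ℝ) := by
  refine Measurable.measure_of_isPiSystem_of_isProbabilityMeasure (S := {s | IsClosed s}) ?_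
    isPiSystem_isClosed fun F hF => ?_
  · rw [BorelSpace.measurable_eq (α := ℝ), borel_eq_generateFrom_isClosed]
  · have hF : IsClosed F := hF
    refine measurable_of_tendsto_metrizable (f := fun n x => ∫⁻ y, hF.apprSeq n y ∂(f x : Measure ℝ))
      (fun n => Continuous.measurable ?_)
      (tendsto_pi_nhds.2 fun x => HasOuterApproxClosed.tendsto_lintegral_apprSeq hF (f x : Measure ℝ))
    exact continuous_iff_continuousAt.2 fun x =>
      ProbabilityMeasure.tendsto_iff_forall_lintegral_tendsto.1 (hf.tendsto x) _

theorem IsInfDiv.aemeasurable_convPow {μ : Measure ℝ} (hμ : IsInfDiv μ) (m : Measure ℝ) :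
    AEMeasurable (convPow μ) (m.restrict (Ioi 0)) := by
  obtain ⟨φ, hφ⟩ := hμ.exists_isCharExponent
  refine aemeasurable_restrict_of_measurable_subtype measurableSet_Ioi ?_
  let f : Ioi (0 : ℝ) → ProbabilityMeasure ℝ :=
    fun s => ⟨convPow μ s, hμ.isProbabilityMeasure_convPow (le_of_lt s.2)⟩
  refine measurable_toMeasure_of_continuous (f := f) (continuous_iff_seqContinuous.2 ?_)
  intro u s hu
  refine ProbabilityMeasure.tendsto_of_tendsto_charFun fun t => ?_
  have h : ∀ s, charFun (f s : Measure ℝ) t = Complex.exp ((s : ℝ) * φ t) :=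
    fun s => hμ.charFun_convPow hφ (le_of_lt s.2) t
  simp only [Function.comp_apply, h]
  have hc : Continuous fun r : Ioi (0 : ℝ) => Complex.exp ((r : ℝ) * φ t) := by fun_prop
  exact (hc.tendsto s).comp hu

/-- Since `f` vanishes at `0`, deleting the mass at `0` does not change the integral. -/
theorem IsInfDiv.lintegral_levyMix {μ : Measure ℝ} (hμ : IsInfDiv μ) (m : Measure ℝ)
    {f : ℝ → ENNReal} (hf : Measurable f) (h0 : f 0 = 0) :
    ∫⁻ x, f x ∂levyMix μ m = ∫⁻ s in Ioi 0, ∫⁻ x, f x ∂convPow μ s ∂m := by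
  rw [levyMix, ← lintegral_indicator (measurableSet_singleton 0).compl,
    indicator_eq_self.2, Measure.lintegral_bind (hμ.aemeasurable_convPow m) hf.aemeasurable]
  intro x hx hx0
  rw [mem_singleton_iff] at hx0
  exact hx (hx0 ▸ h0)

theorem convPow_dirac_zero (s : ℝ) : convPow (Measure.dirac 0) s = Measure.dirac 0 :=
  convPow_eq_of_charFun (φ := 0) ⟨continuous_const, rfl, by simp⟩ (by simp)

theorem levyMix_dirac_zero (m : Measure ℝ) : levyMix (Measure.dirac 0) m = 0 := by
  rw [levyMix, show convPow (Measure.dirac 0) = fun _ => Measure.dirac 0 from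
    funext convPow_dirac_zero, Measure.bind_const, Measure.restrict_smul]
  simp [Measure.restrict_eq_zero.2]

/-! ### Laws on the half-line and their Laplace transforms. -/

theorem measure_Iio_zero_of_convIter {ν : Measure ℝ} [IsProbabilityMeasure ν] {n : ℕ} (hn : 0 < n)
    (h : convIter ν n (Iio 0) = 0) : ν (Iio 0) = 0 := by
  -- A sum of negative terms is negative.
  have key : ∀ n ≥ 1, ν (Iio 0) ^ n ≤ convIter ν n (Iio 0) := by
    intro n hn
    induction n, hn using Nat.le_induction with
    | base => simp [convIter]
    | succ n hn ih =>
      have := isProbabilityMeasure_convIter ν n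
      rw [convIter, Measure.conv, Measure.map_apply (by fun_prop) measurableSet_Iio, pow_succ]
      refine (mul_le_mul_left ih _).trans ?_
      rw [← Measure.prod_prod]
      refine measure_mono fun x hx => ?_
      simp only [mem_prod, mem_Iio, mem_preimage] at hx ⊢
      linarith
  exact eq_zero_of_pow_eq_zero (le_zero_iff.1 (h ▸ key n hn))

theorem convIter_Iio_zero {ν : Measure ℝ} [IsProbabilityMeasure ν] (h : ν (Iio 0) = 0) (n : ℕ) :
    convIter ν n (Iio 0) = 0 := by
  induction n with
  | zero => simp [convIter]
  | succ n ih =>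
    have := isProbabilityMeasure_convIter ν n
    rw [convIter, Measure.conv, Measure.map_apply (by fun_prop) measurableSet_Iio]
    refine measure_mono_null (t := Iio 0 ×ˢ univ ∪ univ ×ˢ Iio 0) (fun x hx => ?_) ?_
    · simp only [mem_preimage, mem_Iio, mem_union, mem_prod, mem_univ, and_true, true_and] at hx ⊢
      by_contra! hc
      linarith [hc.1, hc.2]
    · rw [measure_union_null_iff, Measure.prod_prod, Measure.prod_prod, ih, h]
      simp

theorem measure_Iio_zero_of_tendsto {μs : ℕ → ProbabilityMeasure ℝ} {P : ProbabilityMeasure ℝ}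
    (h : Tendsto μs atTop (𝓝 P)) (h0 : ∀ k, (μs k : Measure ℝ) (Iio 0) = 0) :
    (P : Measure ℝ) (Iio 0) = 0 := by
  have := ProbabilityMeasure.le_liminf_measure_open_of_tendsto h (isOpen_Iio (a := (0 : ℝ)))
  simpa [h0] using this

theorem lintegral_exp_convIter (ν : Measure ℝ) [IsProbabilityMeasure ν] (r : ℝ) (n : ℕ) :
    ∫⁻ x, ENNReal.ofReal (Real.exp (r * x)) ∂convIter ν n =
      (∫⁻ x, ENNReal.ofReal (Real.exp (r * x)) ∂ν) ^ n := by
  induction n with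
  | zero => simp [convIter]
  | succ n ih =>
    have := isProbabilityMeasure_convIter ν n
    rw [convIter, Measure.lintegral_conv (by fun_prop), pow_succ, ← ih,
      ← lintegral_mul_const _ (by fun_prop)]
    refine lintegral_congr fun x => ?_
    rw [← lintegral_const_mul _ (by fun_prop)]
    refine lintegral_congr fun y => ?_
    rw [← ENNReal.ofReal_mul (Real.exp_nonneg _), ← Real.exp_add, mul_add]

theorem ae_nonneg_of_measure_Iio {P : Measure ℝ} (h : P (Iio 0) = 0) : ∀ᵐ x ∂P, 0 ≤ x := by
  rw [ae_iff]
  simpa [Iio] using h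

/-- For `r ≤ 0`, the right-hand integrand is bounded and continuous on all of `ℝ`, as weak
convergence requires. -/
theorem lintegral_exp_max_eq {P : Measure ℝ} (h : P (Iio 0) = 0) (r : ℝ) :
    ∫⁻ x, ENNReal.ofReal (Real.exp (r * x)) ∂P =
      ∫⁻ x, ENNReal.ofReal (Real.exp (r * max x 0)) ∂P := by
  refine lintegral_congr_ae ?_
  filter_upwards [ae_nonneg_of_measure_Iio h] with x hx
  rw [max_eq_left hx]

theorem IsInfDiv.convPow_Iio_zero {μ : Measure ℝ} (hμ : IsInfDiv μ) (h0 : μ (Iio 0) = 0) {s : ℝ}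
    (hs : 0 ≤ s) : convPow μ s (Iio 0) = 0 := by
  obtain ⟨φ, hφ⟩ := hμ.exists_isCharExponent
  obtain ⟨P, p, ν, μs, hP, -, hν, -, hlim⟩ := hμ.exists_tendsto_convPow hφ hs
  rw [← hP]
  refine measure_Iio_zero_of_tendsto hlim fun k => ?_
  obtain ⟨h1, h2, h3⟩ := hν k
  rw [h3]
  exact convIter_Iio_zero (measure_Iio_zero_of_convIter k.succ_pos (h2 ▸ h0)) _

/-- The formula is elementary for integer powers of roots, and passes to their weak limit `μ^s`. -/
theorem IsInfDiv.lintegral_exp_convPow {μ : Measure ℝ} (hμ : IsInfDiv μ) (h0 : μ (Iio 0) = 0)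
    {l u : ℝ} (hl : 0 ≤ l)
    (hu : ∫⁻ x, ENNReal.ofReal (Real.exp (-l * x)) ∂μ = ENNReal.ofReal (Real.exp (-u)))
    {s : ℝ} (hs : 0 ≤ s) :
    ∫⁻ x, ENNReal.ofReal (Real.exp (-l * x)) ∂convPow μ s =
      ENNReal.ofReal (Real.exp (-(s * u))) := by
  obtain ⟨φ, hφ⟩ := hμ.exists_isCharExponent
  obtain ⟨P, p, ν, μs, hP, -, hν, hp, hlim⟩ := hμ.exists_tendsto_convPow hφ hs
  have hk : ∀ k, (μs k : Measure ℝ) (Iio 0) = 0 ∧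
      ∫⁻ x, ENNReal.ofReal (Real.exp (-l * x)) ∂(μs k : Measure ℝ) =
        ENNReal.ofReal (Real.exp (-((p k : ℝ) / ((k + 1 : ℕ) : ℝ) * u))) := by
    intro k
    obtain ⟨h1, h2, h3⟩ := hν k
    have hroot : ∫⁻ x, ENNReal.ofReal (Real.exp (-l * x)) ∂(ν k) =
        ENNReal.ofReal (Real.exp (-(u / ((k + 1 : ℕ) : ℝ)))) := by
      refine (ENNReal.pow_right_strictMono k.succ_ne_zero).injective ?_
      change _ ^ (k + 1) = _ ^ (k + 1)
      rw [← lintegral_exp_convIter, h2, hu, ← ENNReal.ofReal_pow (Real.exp_nonneg _),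
        ← Real.exp_nat_mul]
      congr 2
      field_simp
    rw [h3]
    refine ⟨convIter_Iio_zero (measure_Iio_zero_of_convIter k.succ_pos (h2 ▸ h0)) _, ?_⟩
    rw [lintegral_exp_convIter, hroot, ← ENNReal.ofReal_pow (Real.exp_nonneg _),
      ← Real.exp_nat_mul]
    congr 2
    field_simp
  rw [lintegral_exp_max_eq (hμ.convPow_Iio_zero h0 hs), ← hP]
  let f : BoundedContinuousFunction ℝ NNReal :=
    .mkOfBound ⟨fun x => (Real.exp (-l * max x 0)).toNNReal, by fun_prop⟩ 1 fun x y => by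
      have hle : ∀ z : ℝ, Real.exp (-l * max z 0) ≤ 1 := fun z => by
        rw [Real.exp_le_one_iff]
        nlinarith [le_max_right z 0]
      have hx := hle x
      have hy := hle y
      have hx0 := Real.exp_pos (-l * max x 0)
      have hy0 := Real.exp_pos (-l * max y 0)
      rw [NNReal.dist_eq, abs_le]
      simp only [ContinuousMap.coe_mk, Real.coe_toNNReal _ (Real.exp_nonneg _)]
      constructor <;> linarith
  have hf := ProbabilityMeasure.tendsto_iff_forall_lintegral_tendsto.1 hlim f
  refine tendsto_nhds_unique hf ?_
  have : ∀ k, ∫⁻ x, f x ∂(μs k : Measure ℝ) =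
      ENNReal.ofReal (Real.exp (-((p k : ℝ) / ((k + 1 : ℕ) : ℝ) * u))) := fun k => by
    rw [← (hk k).2, lintegral_exp_max_eq (hk k).1]
    rfl
  simp_rw [this]
  have hc : Continuous fun r : ℝ => ENNReal.ofReal (Real.exp (-(r * u))) :=
    ENNReal.continuous_ofReal.comp (by fun_prop)
  exact (hc.tendsto s).comp hp

theorem lintegral_one_sub_exp {P : Measure ℝ} [IsProbabilityMeasure P] (h0 : P (Iio 0) = 0)
    {l u : ℝ} (hl : 0 ≤ l)
    (hu : ∫⁻ x, ENNReal.ofReal (Real.exp (-l * x)) ∂P = ENNReal.ofReal (Real.exp (-u))) :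
    ∫⁻ x, (1 - ENNReal.ofReal (Real.exp (-l * x))) ∂P = ENNReal.ofReal (1 - Real.exp (-u)) := by
  rw [lintegral_sub (by fun_prop) (by rw [hu]; exact ENNReal.ofReal_ne_top), hu, lintegral_one,
    measure_univ, ENNReal.ofReal_sub _ (Real.exp_nonneg _), ENNReal.ofReal_one]
  filter_upwards [ae_nonneg_of_measure_Iio h0] with x hx
  rw [ENNReal.ofReal_le_one, Real.exp_le_one_iff]
  nlinarith

/-! ### Test functions for the mixing map. -/

theorem eq_dirac_zero_of_ae {P : Measure ℝ} [IsProbabilityMeasure P] (h : ∀ᵐ x ∂P, x = 0) :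
    P = Measure.dirac 0 := by
  refine Measure.ext fun s hs => ?_
  by_cases h0 : (0 : ℝ) ∈ s
  · rw [Measure.dirac_apply' _ hs, indicator_of_mem h0, Pi.one_apply, ← prob_compl_eq_zero_iff hs]
    refine measure_mono_null (fun x hx => ?_) (ae_iff.1 h)
    rintro rfl
    exact hx h0
  · rw [Measure.dirac_apply' _ hs, indicator_of_notMem h0]
    refine measure_mono_null (fun x hx => ?_) (ae_iff.1 h)
    rintro rfl
    exact h0 hx

/-- The functions `1 - exp (-s u)`, for `u` in a right neighbourhood of `0`, are integrals
of test functions vanishing at `0` against the convolution powers `μ^s`. -/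
theorem IsInfDiv.exists_test_of_nonneg {μ : Measure ℝ} (hμ : IsInfDiv μ) (h0 : μ (Iio 0) = 0)
    (hne : μ ≠ Measure.dirac 0) :
    ∃ u₀ > 0, ∀ u ∈ Ioc 0 u₀, ∃ f : ℝ → ENNReal, Measurable f ∧ f 0 = 0 ∧
      ∀ s > 0, ∫⁻ x, f x ∂convPow μ s = ENNReal.ofReal (1 - Real.exp (-(s * u))) := by
  have := hμ.1
  -- `|l|` and `max x 0` make this Laplace transform bounded and continuous on the whole line. As `L
  -- 0 = 1` and `L 1 < 1`, it takes every value `exp (-u)` with `u ≤ -log (L 1)`.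
  let L : ℝ → ℝ := fun l => ∫ x, Real.exp (-|l| * max x 0) ∂μ
  have hb : ∀ l x : ℝ, ‖Real.exp (-|l| * max x 0)‖ ≤ 1 := fun l x => by
    rw [Real.norm_eq_abs, Real.abs_exp, Real.exp_le_one_iff]
    nlinarith [abs_nonneg l, le_max_right x 0]
  have hint : ∀ l : ℝ, Integrable (fun x => Real.exp (-|l| * max x 0)) μ := fun l =>
    (integrable_const (1 : ℝ)).mono' (by fun_prop) (.of_forall (hb l))
  have hL : Continuous L := continuous_of_dominated (fun l => by fun_prop)
    (fun l => .of_forall (hb l)) (integrable_const (1 : ℝ)) (.of_forall fun x => by fun_prop)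
  have hL0 : L 0 = 1 := by simp [L]
  have hL1 : 0 < L 1 := integral_exp_pos (hint 1)
  have hL1' : L 1 < 1 := by
    by_contra! hge
    apply hne
    have hi : Integrable (fun x => 1 - Real.exp (-|1| * max x 0)) μ :=
      (integrable_const (1 : ℝ)).sub (hint 1)
    have hnn : ∀ x : ℝ, 0 ≤ 1 - Real.exp (-|1| * max x 0) := fun x => by
      have := hb 1 x
      rw [Real.norm_eq_abs, Real.abs_exp] at this
      linarith
    have hz : ∫ x, (1 - Real.exp (-|1| * max x 0)) ∂μ = 0 := by
      refine le_antisymm ?_ (integral_nonneg hnn)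
      rw [integral_sub (integrable_const _) (hint 1)]
      change ∫ _, (1 : ℝ) ∂μ - L 1 ≤ 0
      simpa using hge
    rw [integral_eq_zero_iff_of_nonneg hnn hi] at hz
    refine eq_dirac_zero_of_ae ?_
    filter_upwards [hz, ae_nonneg_of_measure_Iio h0] with x hx hx0
    have : Real.exp (-|1| * max x 0) = 1 := by
      have : 1 - Real.exp (-|1| * max x 0) = 0 := hx
      linarith
    rw [Real.exp_eq_one_iff, max_eq_left hx0] at this
    simpa using this
  refine ⟨-Real.log (L 1), by linarith [Real.log_neg hL1 hL1'], fun u hu => ?_⟩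
  obtain ⟨l, hl, hlu⟩ := intermediate_value_Icc' (zero_le_one' ℝ) hL.continuousOn
    (show Real.exp (-u) ∈ Icc (L 1) (L 0) from
      ⟨by rw [← Real.exp_log hL1]; exact Real.exp_le_exp.2 (by linarith [hu.2]),
        by rw [hL0, Real.exp_le_one_iff]; linarith [hu.1]⟩)
  have hlμ : ∫⁻ x, ENNReal.ofReal (Real.exp (-l * x)) ∂μ = ENNReal.ofReal (Real.exp (-u)) := by
    rw [lintegral_exp_max_eq h0, ← hlu, ofReal_integral_eq_lintegral_ofReal (hint l)
      (.of_forall fun x => Real.exp_nonneg _), abs_of_nonneg hl.1]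
  refine ⟨fun x => 1 - ENNReal.ofReal (Real.exp (-l * x)), by fun_prop, by simp, fun s hs => ?_⟩
  have := hμ.isProbabilityMeasure_convPow hs.le
  exact lintegral_one_sub_exp (hμ.convPow_Iio_zero h0 hs.le) hl.1
    (hμ.lintegral_exp_convPow h0 hl.1 hlμ hs.le)

theorem lintegral_one_sub_cos (P : Measure ℝ) [IsProbabilityMeasure P] (t : ℝ) :
    ∫⁻ x, ENNReal.ofReal (1 - Real.cos (t * x)) ∂P = ENNReal.ofReal (1 - (charFun P t).re) := by
  have hi : Integrable (fun x => 1 - Real.cos (t * x)) P :=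
    (integrable_const _).sub (integrable_cos_mul P t)
  rw [one_sub_re_charFun, ofReal_integral_eq_lintegral_ofReal hi]
  exact .of_forall fun x => by simpa using Real.cos_le_one _

theorem IsInfDiv.exists_test_of_symm {μ : Measure ℝ} (hμ : IsInfDiv μ)
    (hs : μ.map (fun x => -x) = μ) (hne : μ ≠ Measure.dirac 0) :
    ∃ u₀ > 0, ∀ u ∈ Ioc 0 u₀, ∃ f : ℝ → ENNReal, Measurable f ∧ f 0 = 0 ∧
      ∀ s > 0, ∫⁻ x, f x ∂convPow μ s = ENNReal.ofReal (1 - Real.exp (-(s * u))) := by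
  have := hμ.1
  obtain ⟨φ, hφ⟩ := hμ.exists_isCharExponent
  -- By symmetry the conjugate of `φ` is also a characteristic exponent, so uniqueness makes `φ`
  -- real.
  have hreal : ∀ t, φ t = ((φ t).re : ℂ) := by
    have hc := hφ.1
    have h : IsCharExponent μ fun t => (starRingEnd ℂ) (φ t) := by
      refine ⟨Complex.continuous_conj.comp hc, by simp [hφ.2.1], fun t => ?_⟩
      rw [Complex.exp_conj, ← hφ.2.2, ← charFun_neg, ← charFun_map_neg, hs]
    intro t
    exact (Complex.conj_eq_iff_re.1 (congrFun (h.unique hφ) t)).symm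
  have hch : ∀ t, charFun μ t = (Real.exp (φ t).re : ℂ) := fun t => by
    rw [hφ.2.2, hreal t]; simp
  obtain ⟨t, ht⟩ : ∃ t, (φ t).re < 0 := by
    by_contra! hc
    apply hne
    refine Measure.ext_of_charFun (funext fun t => ?_)
    have h1 := norm_charFun_le_one (μ := μ) t
    rw [hch, Complex.norm_real, Real.norm_eq_abs, Real.abs_exp, Real.exp_le_one_iff] at h1
    rw [hch, le_antisymm h1 (hc t)]
    simp
  have hcont : Continuous fun r : ℝ => -(φ (r * t)).re := by
    have := hφ.1
    fun_prop
  refine ⟨-(φ t).re, by linarith, fun u hu => ?_⟩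
  obtain ⟨r, -, hr⟩ := intermediate_value_Icc (zero_le_one' ℝ) hcont.continuousOn
    (show u ∈ Icc (-(φ (0 * t)).re) (-(φ (1 * t)).re) from
      ⟨by simpa [hφ.2.1] using hu.1.le, by simpa using hu.2⟩)
  refine ⟨fun x => ENNReal.ofReal (1 - Real.cos (r * t * x)), by fun_prop, by simp, fun s hs => ?_⟩
  have := hμ.isProbabilityMeasure_convPow hs.le
  have hr' : (φ (r * t)).re = -u := by rw [← hr, neg_neg]
  rw [lintegral_one_sub_cos, hμ.charFun_convPow hφ hs.le, hreal, hr', ← Complex.ofReal_mul,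
    ← Complex.ofReal_exp, Complex.ofReal_re, mul_neg]

/-! ### Uniqueness for Laplace transforms and Bernstein functions. -/

theorem eq_of_withDensity_eq {m m' : Measure ℝ} {g : ℝ → ENNReal} (hg : Measurable g)
    (h : ∀ᵐ x ∂m, g x ≠ 0) (h' : ∀ᵐ x ∂m', g x ≠ 0) (htop : ∀ x, g x ≠ ⊤)
    (he : m.withDensity g = m'.withDensity g) : m = m' := by
  rw [← withDensity_inv_same hg h (.of_forall htop), he,
    withDensity_inv_same hg h' (.of_forall htop)]

theorem isFiniteMeasure_withDensity_of_le {m : Measure ℝ} {f g : ℝ → ENNReal} {C : ENNReal}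
    (hC : C ≠ ⊤) (hf : ∫⁻ x, f x ∂m < ⊤) (hgf : ∀ᵐ x ∂m, g x ≤ C * f x) :
    IsFiniteMeasure (m.withDensity g) := by
  refine isFiniteMeasure_withDensity (lt_of_le_of_lt (lintegral_mono_ae hgf) ?_).ne
  rw [lintegral_const_mul' _ _ hC]
  exact ENNReal.mul_lt_top hC.lt_top hf

theorem charFun_withDensity (κ : Measure ℝ) {g : ℝ → ℝ} (hg : Measurable g) (hg0 : ∀ x, 0 ≤ g x)
    (t : ℝ) : charFun (κ.withDensity fun x => ENNReal.ofReal (g x)) t =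
      ∫ x, (g x : ℂ) * Complex.exp (t * x * Complex.I) ∂κ := by
  rw [charFun_apply_real, integral_withDensity_eq_integral_toReal_smul (by fun_prop)
    (.of_forall fun x => ENNReal.ofReal_lt_top)]
  simp [ENNReal.toReal_ofReal, hg0]

theorem integrable_exp_mul_of_nonneg {κ : Measure ℝ} [IsFiniteMeasure κ] (h0 : κ (Iio 0) = 0)
    {r : ℝ} (hr : r ≤ 0) : Integrable (fun x => Real.exp (r * x)) κ := by
  refine (integrable_const (1 : ℝ)).mono' (by fun_prop) ?_
  filter_upwards [ae_nonneg_of_measure_Iio h0] with x hx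
  rw [Real.norm_eq_abs, Real.abs_exp, Real.exp_le_one_iff]
  nlinarith

theorem Iio_subset_interior_integrableExpSet {κ : Measure ℝ} [IsFiniteMeasure κ]
    (h0 : κ (Iio 0) = 0) : Iio 0 ⊆ interior (integrableExpSet id κ) :=
  interior_maximal (fun _ hr => integrable_exp_mul_of_nonneg h0 (le_of_lt hr)) isOpen_Iio

/-- Both complex moment generating functions are analytic on `Re z < 0` and agree on a real
interval, hence on the half-plane. -/
theorem ext_of_lintegral_exp {κ κ' : Measure ℝ} [IsFiniteMeasure κ] [IsFiniteMeasure κ']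
    (h0 : κ (Iio 0) = 0) (h0' : κ' (Iio 0) = 0) {v : ℝ} (hv : 0 < v)
    (h : ∀ u ∈ Ioc 0 v, ∫⁻ x, ENNReal.ofReal (Real.exp (-u * x)) ∂κ =
      ∫⁻ x, ENNReal.ofReal (Real.exp (-u * x)) ∂κ') : κ = κ' := by
  have hmgf : ∀ u ∈ Ioc 0 v, complexMGF id κ (-u : ℝ) = complexMGF id κ' (-u : ℝ) := by
    intro u hu
    rw [complexMGF_ofReal, complexMGF_ofReal, mgf, mgf,
      integral_eq_lintegral_of_nonneg_ae (.of_forall fun _ => Real.exp_nonneg _) (by fun_prop),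
      integral_eq_lintegral_of_nonneg_ae (.of_forall fun _ => Real.exp_nonneg _) (by fun_prop)]
    exact congrArg (fun y => ((y.toReal : ℝ) : ℂ)) (h u hu)
  have han : ∀ κ : Measure ℝ, IsFiniteMeasure κ → κ (Iio 0) = 0 →
      AnalyticOnNhd ℂ (complexMGF id κ) {z | z.re < 0} := fun κ _ h0 =>
    analyticOnNhd_complexMGF.mono fun z hz => Iio_subset_interior_integrableExpSet h0 hz
  have hpre : IsPreconnected {z : ℂ | z.re < 0} :=
    (convex_halfSpace_re_lt 0).isPreconnected
  have heq := (han κ inferInstance h0).eqOn_of_preconnected_of_frequently_eq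
    (han κ' inferInstance h0') hpre (z₀ := ((-(v / 2) : ℝ) : ℂ)) (by simpa using hv) (by
      have hev : ∃ᶠ r : ℝ in 𝓝[≠] (-(v / 2)), complexMGF id κ r = complexMGF id κ' r := by
        refine Eventually.frequently ?_
        filter_upwards [nhdsWithin_le_nhds (Ioo_mem_nhds (show -v < -(v / 2) by linarith)
          (show -(v / 2) < 0 by linarith))] with r hr
        have := hmgf (-r) ⟨by linarith [hr.2], by linarith [hr.1]⟩
        simpa using this
      have ht : Tendsto (fun r : ℝ => (r : ℂ)) (𝓝[≠] (-(v / 2))) (𝓝[≠] ((-(v / 2) : ℝ) : ℂ)) :=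
        tendsto_nhdsWithin_of_tendsto_nhds_of_eventually_within _
          ((Complex.continuous_ofReal.tendsto _).mono_left nhdsWithin_le_nhds)
          (by filter_upwards [self_mem_nhdsWithin] with r hr
              exact fun hc => hr (Complex.ofReal_injective hc))
      exact ht.frequently hev)
  -- The imaginary axis is only the boundary of the half-plane. The line `Re z = -1` is used
  -- instead: there one reads off the characteristic function of the measure tilted by `exp (-x)`.
  have htilt : ∀ κ : Measure ℝ, IsFiniteMeasure κ → κ (Iio 0) = 0 →
      IsFiniteMeasure (κ.withDensity fun x => ENNReal.ofReal (Real.exp (-1 * x))) := by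
    intro κ _ h0
    refine isFiniteMeasure_withDensity_of_le (f := 1) (C := 1) (by simp) (by simp) ?_
    filter_upwards [ae_nonneg_of_measure_Iio h0] with x hx
    simpa using hx
  have := htilt κ inferInstance h0
  have := htilt κ' inferInstance h0'
  refine eq_of_withDensity_eq (g := fun x => ENNReal.ofReal (Real.exp (-1 * x))) (by fun_prop)
    (.of_forall fun x => by simp [Real.exp_pos]) (.of_forall fun x => by simp [Real.exp_pos])
    (fun x => ENNReal.ofReal_ne_top) (Measure.ext_of_charFun (funext fun t => ?_))
  have hz := @heq (-1 + t * Complex.I) (by simp)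
  rw [charFun_withDensity _ (by fun_prop) fun _ => Real.exp_nonneg _,
    charFun_withDensity _ (by fun_prop) fun _ => Real.exp_nonneg _]
  have hrw : ∀ x : ℝ, ((Real.exp (-1 * x) : ℝ) : ℂ) * Complex.exp (t * x * Complex.I) =
      Complex.exp ((-1 + t * Complex.I) * x) := fun x => by
    rw [Complex.ofReal_exp, ← Complex.exp_add]
    congr 1
    push_cast
    ring
  simp_rw [hrw]
  exact hz

theorem one_sub_exp_le {v x : ℝ} (hv : 0 ≤ v) (hx : 0 ≤ x) :
    1 - Real.exp (-(x * v)) ≤ (1 + v) * min 1 |x| := by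
  have h1 := Real.add_one_le_exp (-(x * v))
  have h2 := Real.exp_pos (-(x * v))
  rw [abs_of_nonneg hx]
  rcases le_total 1 x with h | h
  · rw [min_eq_left h]; linarith
  · rw [min_eq_right h]; nlinarith

theorem ext_of_lintegral_one_sub_exp {m m' : Measure ℝ} (h0 : m (Iic 0) = 0)
    (h0' : m' (Iic 0) = 0) (hm : ∫⁻ x, ENNReal.ofReal (min 1 |x|) ∂m < ⊤)
    (hm' : ∫⁻ x, ENNReal.ofReal (min 1 |x|) ∂m' < ⊤) {u₀ : ℝ} (hu₀ : 0 < u₀)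
    (h : ∀ u ∈ Ioc 0 u₀, ∫⁻ x, ENNReal.ofReal (1 - Real.exp (-(x * u))) ∂m =
      ∫⁻ x, ENNReal.ofReal (1 - Real.exp (-(x * u))) ∂m') : m = m' := by
  -- With this choice `u` and `u + v` both lie in `(0, u₀]` for `u ≤ v`. The increment of the
  -- Bernstein function from `u` to `u + v` is the Laplace transform at `u` of the finite measure
  -- with density `1 - exp (-x v)`.
  set v := u₀ / 2 with hv
  have hv0 : 0 < v := by positivity
  let g : ℝ → ENNReal := fun x => ENNReal.ofReal (1 - Real.exp (-(x * v)))
  have hg : Measurable g := by fun_prop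
  have hpos : ∀ m : Measure ℝ, m (Iic 0) = 0 → ∀ᵐ x ∂m, 0 < x := fun m h0 => by
    rw [ae_iff]; simpa [Iic] using h0
  have hbd : ∀ m : Measure ℝ, m (Iic 0) = 0 → ∀ u > 0, ∀ᵐ x ∂m,
      ENNReal.ofReal (1 - Real.exp (-(x * u))) ≤
        ENNReal.ofReal (1 + u) * ENNReal.ofReal (min 1 |x|) := by
    intro m h0 u hu
    filter_upwards [hpos m h0] with x hx
    rw [← ENNReal.ofReal_mul (by positivity)]
    exact ENNReal.ofReal_le_ofReal (one_sub_exp_le hu.le hx.le)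
  have hfin : ∀ m : Measure ℝ, m (Iic 0) = 0 → ∫⁻ x, ENNReal.ofReal (min 1 |x|) ∂m < ⊤ →
      IsFiniteMeasure (m.withDensity g) := fun m h0 hm =>
    isFiniteMeasure_withDensity_of_le ENNReal.ofReal_ne_top hm (hbd m h0 v hv0)
  have hadd : ∀ m : Measure ℝ, m (Iic 0) = 0 → ∀ u > 0,
      ∫⁻ x, ENNReal.ofReal (1 - Real.exp (-(x * u))) ∂m +
        ∫⁻ x, ENNReal.ofReal (Real.exp (-u * x)) ∂(m.withDensity g) =
      ∫⁻ x, ENNReal.ofReal (1 - Real.exp (-(x * (u + v)))) ∂m := by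
    intro m h0 u hu
    rw [lintegral_withDensity_eq_lintegral_mul _ hg (by fun_prop), ← lintegral_add_left (by fun_prop)]
    refine lintegral_congr_ae ?_
    filter_upwards [hpos m h0] with x hx
    have h1 : ∀ w > 0, 0 ≤ 1 - Real.exp (-(x * w)) := fun w hw => by
      rw [sub_nonneg, Real.exp_le_one_iff]
      have := mul_pos hx hw
      linarith
    simp only [g, Pi.mul_apply]
    rw [← ENNReal.ofReal_mul (h1 v hv0), ← ENNReal.ofReal_add (h1 u hu)
      (mul_nonneg (h1 v hv0) (Real.exp_nonneg _))]
    congr 1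
    have e1 : Real.exp (-(x * (u + v))) = Real.exp (-(x * v)) * Real.exp (-u * x) := by
      rw [← Real.exp_add]; congr 1; ring
    have e2 : Real.exp (-(x * u)) = Real.exp (-u * x) := by congr 1; ring
    rw [e1, e2]; ring
  have := hfin m h0 hm
  have := hfin m' h0' hm'
  have hnull : ∀ m : Measure ℝ, m (Iic 0) = 0 → m.withDensity g (Iio 0) = 0 := fun m h0 =>
    withDensity_absolutelyContinuous _ _ (measure_mono_null Iio_subset_Iic_self h0)
  have hne : ∀ m : Measure ℝ, m (Iic 0) = 0 → ∀ᵐ x ∂m, g x ≠ 0 := fun m h0 => by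
    filter_upwards [hpos m h0] with x hx
    have : Real.exp (-(x * v)) < 1 := by
      rw [Real.exp_lt_one_iff]
      have := mul_pos hx hv0
      linarith
    simpa [g] using this
  refine eq_of_withDensity_eq hg (hne m h0) (hne m' h0') (fun x => ENNReal.ofReal_ne_top)
    (ext_of_lintegral_exp (hnull m h0) (hnull m' h0') hv0 fun u hu => ?_)
  have e := hadd m h0 u hu.1
  rw [h (u + v) ⟨by linarith [hu.1], by linarith [hu.2]⟩, ← hadd m' h0' u hu.1,
    h u ⟨hu.1, by linarith [hu.2]⟩] at e
  refine (ENNReal.add_right_inj (ne_of_lt ?_)).1 e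
  refine lt_of_le_of_lt (lintegral_mono_ae (hbd m' h0' u hu.1)) ?_
  rw [lintegral_const_mul' _ _ ENNReal.ofReal_ne_top]
  exact ENNReal.mul_lt_top ENNReal.ofReal_lt_top hm'

/-- The Lévy mixing map of a non-degenerate law that is symmetric or carried by the non-negative
half-line is injective. -/
theorem IsInfDiv.restrict_eq_of_levyMix_eq {μ : Measure ℝ} (hμ : IsInfDiv μ)
    (hsupp : μ.map (fun x => -x) = μ ∨ μ (Iio 0) = 0) (hne : μ ≠ Measure.dirac 0)
    {m m' : Measure ℝ} (hm : ∫⁻ x, ENNReal.ofReal (min 1 |x|) ∂m < ⊤)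
    (hm' : ∫⁻ x, ENNReal.ofReal (min 1 |x|) ∂m' < ⊤) (h : levyMix μ m = levyMix μ m') :
    m.restrict (Ioi 0) = m'.restrict (Ioi 0) := by
  obtain ⟨u₀, hu₀, htest⟩ := hsupp.elim (fun hs => hμ.exists_test_of_symm hs hne)
    (fun h0 => hμ.exists_test_of_nonneg h0 hne)
  have hnull : ∀ m : Measure ℝ, m.restrict (Ioi 0) (Iic 0) = 0 := fun m => by
    rw [Measure.restrict_apply measurableSet_Iic, inter_comm, Ioi_inter_Iic, Ioc_self,
      measure_empty]
  refine ext_of_lintegral_one_sub_exp (hnull m) (hnull m') ((setLIntegral_le_lintegral _ _).trans_lt hm)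
    ((setLIntegral_le_lintegral _ _).trans_lt hm') hu₀ fun u hu => ?_
  obtain ⟨f, hf, hf0, hfu⟩ := htest u hu
  have key : ∀ m : Measure ℝ, ∫⁻ x in Ioi 0, ENNReal.ofReal (1 - Real.exp (-(x * u))) ∂m =
      ∫⁻ x, f x ∂levyMix μ m := fun m => by
    rw [hμ.lintegral_levyMix m hf hf0]
    exact (setLIntegral_congr_fun measurableSet_Ioi fun s hs => hfu s hs).symm
  rw [key, key, h]

/-! ### Lévy exponents and uniqueness of the Lévy measure. -/

theorem abs_trunc_le (x : ℝ) : |trunc x| ≤ min 1 |x| := by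
  unfold trunc
  split_ifs with h
  · exact le_min h le_rfl
  · simp

theorem measurable_trunc : Measurable trunc :=
  Measurable.ite (measurableSet_le (by fun_prop) measurable_const) measurable_id measurable_const

theorem norm_exp_sub_one_le (z x : ℝ) :
    ‖Complex.exp (Complex.I * z * x) - 1‖ ≤ (2 + |z|) * min 1 |x| := by
  have h1 : ‖Complex.exp (Complex.I * z * x) - 1‖ ≤ |z| * |x| := by
    rw [mul_assoc, ← Complex.ofReal_mul]
    simpa using Real.norm_exp_I_mul_ofReal_sub_one_le (x := z * x)
  have h2 : ‖Complex.exp (Complex.I * z * x) - 1‖ ≤ 2 := by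
    refine (norm_sub_le _ _).trans ?_
    rw [mul_assoc, ← Complex.ofReal_mul, Complex.norm_exp_I_mul_ofReal]
    norm_num
  rcases le_total 1 |x| with h | h
  · rw [min_eq_left h]; linarith [abs_nonneg z]
  · rw [min_eq_right h]; nlinarith [abs_nonneg x]

theorem IsLevyMeasureOne.integrable {ρ : Measure ℝ} (hρ : IsLevyMeasureOne ρ) :
    Integrable (fun x => min 1 |x|) ρ :=
  ⟨by fun_prop, by
    rw [hasFiniteIntegral_iff_ofReal (.of_forall fun x => le_min zero_le_one (abs_nonneg x))]
    exact hρ.2.2⟩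

theorem IsLevyMeasureOne.ae_ne_zero {ρ : Measure ℝ} (hρ : IsLevyMeasureOne ρ) :
    ∀ᵐ x ∂ρ, x ≠ 0 := by
  rw [ae_iff]; simpa using hρ.1.1

theorem IsLevyMeasureOne.integrable_exp_sub_one {ρ : Measure ℝ} (hρ : IsLevyMeasureOne ρ)
    (z : ℝ) : Integrable (fun x : ℝ => Complex.exp (Complex.I * z * x) - 1) ρ :=
  (hρ.integrable.const_mul (2 + |z|)).mono' (by fun_prop)
    (.of_forall fun x => norm_exp_sub_one_le z x)

theorem IsLevyMeasureOne.integrable_trunc {ρ : Measure ℝ} (hρ : IsLevyMeasureOne ρ) :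
    Integrable trunc ρ :=
  hρ.integrable.mono' measurable_trunc.aestronglyMeasurable (.of_forall abs_trunc_le)

/-- The exponent of the driftless subordinator with Lévy measure `ρ`. -/
noncomputable def levyExponent (ρ : Measure ℝ) (z : ℝ) : ℂ :=
  ∫ x : ℝ, (Complex.exp (Complex.I * z * x) - 1) ∂ρ

theorem levyExponent_zero (ρ : Measure ℝ) : levyExponent ρ 0 = 0 := by simp [levyExponent]

theorem IsLevyMeasureOne.continuous_levyExponent {ρ : Measure ℝ} (hρ : IsLevyMeasureOne ρ) :
    Continuous (levyExponent ρ) := by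
  refine continuous_iff_continuousAt.2 fun z => ?_
  refine continuousAt_of_dominated (bound := fun x => (2 + (|z| + 1)) * min 1 |x|)
    (.of_forall fun z => by fun_prop) ?_ (hρ.integrable.const_mul _)
    (.of_forall fun x => by fun_prop)
  filter_upwards [(continuous_abs.tendsto z).eventually (gt_mem_nhds (lt_add_one |z|))] with y hy
  refine .of_forall fun x => (norm_exp_sub_one_le y x).trans ?_
  have : 0 ≤ min 1 |x| := le_min zero_le_one (abs_nonneg x)
  gcongr

theorem IsLevyMeasureOne.integral_triplet {ρ : Measure ℝ} (hρ : IsLevyMeasureOne ρ) (z : ℝ) :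
    ∫ x, (Complex.exp (Complex.I * z * x) - 1 - Complex.I * trunc x * z) ∂ρ =
      levyExponent ρ z - Complex.I * z * ((∫ x, trunc x ∂ρ : ℝ) : ℂ) := by
  have h : ∀ x : ℝ, Complex.I * trunc x * z = (Complex.I * z) * ((trunc x : ℝ) : ℂ) :=
    fun x => by ring
  have hi : Integrable (fun x => (Complex.I * z) * ((trunc x : ℝ) : ℂ)) ρ :=
    hρ.integrable_trunc.ofReal.const_mul _
  simp_rw [h]
  rw [integral_sub (hρ.integrable_exp_sub_one z) hi, integral_const_mul, integral_complex_ofReal,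
    levyExponent]

/-- Second differences kill the drift, turn the Gaussian term into the constant `b * w ^ 2`, and
weight `ρ` into a finite measure. -/
theorem IsLevyMeasureOne.second_difference {ρ : Measure ℝ} (hρ : IsLevyMeasureOne ρ)
    (z w : ℝ) : 2 * levyExponent ρ z - levyExponent ρ (z + w) - levyExponent ρ (z - w) =
      ∫ x : ℝ, ((2 - 2 * Real.cos (w * x) : ℝ) : ℂ) * Complex.exp (z * x * Complex.I) ∂ρ := by
  have hi0 := (hρ.integrable_exp_sub_one z).const_mul 2
  have hi1 := hρ.integrable_exp_sub_one (z + w)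
  have hi2 := hρ.integrable_exp_sub_one (z - w)
  have hi : Integrable (fun x : ℝ => 2 * (Complex.exp (Complex.I * z * x) - 1) -
    (Complex.exp (Complex.I * ((z + w : ℝ) : ℂ) * x) - 1)) ρ := hi0.sub hi1
  simp only [levyExponent]
  rw [← integral_const_mul, ← integral_sub hi0 hi1, ← integral_sub hi hi2]
  refine integral_congr_ae (.of_forall fun x => ?_)
  have e1 : Complex.exp (Complex.I * ((z + w : ℝ) : ℂ) * x) =
      Complex.exp (z * x * Complex.I) * Complex.exp (w * x * Complex.I) := by
    rw [← Complex.exp_add]; congr 1; push_cast; ring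
  have e2 : Complex.exp (Complex.I * ((z - w : ℝ) : ℂ) * x) =
      Complex.exp (z * x * Complex.I) * Complex.exp (-(w * x) * Complex.I) := by
    rw [← Complex.exp_add]; congr 1; push_cast; ring
  have e3 : Complex.exp (Complex.I * z * x) = Complex.exp (z * x * Complex.I) := by
    congr 1; ring
  have e4 : ((2 - 2 * Real.cos (w * x) : ℝ) : ℂ) =
      2 - (Complex.exp (w * x * Complex.I) + Complex.exp (-(w * x) * Complex.I)) := by
    rw [← Complex.two_cos]; push_cast; ring
  simp only [e1, e2, e3, e4]
  ring

theorem two_sub_two_cos_le (w x : ℝ) : 2 - 2 * Real.cos (w * x) ≤ (4 + 2 * |w|) * min 1 |x| := by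
  have h := norm_exp_sub_one_le w x
  have h2 := (Complex.abs_re_le_norm _).trans h
  have e : (Complex.exp (Complex.I * w * x) - 1).re = Real.cos (w * x) - 1 := by
    rw [mul_assoc, ← Complex.ofReal_mul, mul_comm, Complex.sub_re, Complex.exp_ofReal_mul_I_re,
      Complex.one_re]
  rw [e] at h2
  linarith [neg_le_of_abs_le h2]

theorem charFun_add_smul_dirac {κ : Measure ℝ} [IsFiniteMeasure κ] {c : ℝ} (hc : 0 ≤ c) (t : ℝ) :
    charFun (κ + ENNReal.ofReal c • Measure.dirac 0) t = charFun κ t + c := by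
  have hi : ∀ κ : Measure ℝ, IsFiniteMeasure κ →
      Integrable (fun x : ℝ => Complex.exp (t * x * Complex.I)) κ := by
    intro κ _
    refine (integrable_const (1 : ℝ)).mono' (by fun_prop) (.of_forall fun x => ?_)
    rw [← Complex.ofReal_mul, Complex.norm_exp_ofReal_mul_I]
  have hf : IsFiniteMeasure (ENNReal.ofReal c • (Measure.dirac 0 : Measure ℝ)) :=
    Measure.smul_finite _ ENNReal.ofReal_ne_top
  rw [charFun_apply_real, integral_add_measure (hi κ inferInstance) (hi _ hf),
    integral_smul_measure, ← charFun_apply_real]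
  simp [ENNReal.toReal_ofReal hc]

theorem two_sub_two_cos_nonneg (y : ℝ) : 0 ≤ 2 - 2 * Real.cos y := by
  linarith [Real.cos_le_one y]

/-- The weight `2 - 2 cos (w x)` has nonzero zeros; two incommensurable frequencies share only `x =
0`. -/
theorem eq_zero_of_cos_eq_one {x : ℝ} (h1 : Real.cos (1 * x) = 1)
    (h2 : Real.cos (√2 * x) = 1) : x = 0 := by
  rw [Real.cos_eq_one_iff] at h1 h2
  obtain ⟨n, hn⟩ := h1
  obtain ⟨k, hk⟩ := h2
  rw [one_mul] at hn
  by_contra hx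
  have hn0 : (n : ℝ) ≠ 0 := by
    rintro h
    rw [h, zero_mul] at hn
    exact hx hn.symm
  refine irrational_sqrt_two ⟨(k : ℚ) / n, ?_⟩
  push_cast
  rw [← hn] at hk
  field_simp
  have : (k : ℝ) * (2 * Real.pi) = (n * √2) * (2 * Real.pi) := by rw [hk]; ring
  exact mul_right_cancel₀ Real.two_pi_pos.ne' this

theorem HasTriplet.charFun_eq {η ρ : Measure ℝ} {γ b : ℝ} (h : HasTriplet η γ b ρ)
    (hρ : IsLevyMeasureOne ρ) (z : ℝ) :
    charFun η z = Complex.exp (Complex.I * z * ((γ - ∫ x, trunc x ∂ρ : ℝ) : ℂ) -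
      (1 / 2) * (z : ℂ) ^ 2 * b + levyExponent ρ z) := by
  rw [h.2.2, hρ.integral_triplet]
  congr 1
  push_cast
  ring

/-- A law determines its Lévy measure. -/
theorem HasLevyMeasure.unique {η ρ ρ' : Measure ℝ} (h : HasLevyMeasure η ρ)
    (h' : HasLevyMeasure η ρ') (hρ : IsLevyMeasureOne ρ) (hρ' : IsLevyMeasureOne ρ') :
    ρ = ρ' := by
  obtain ⟨γ, b, h⟩ := h
  obtain ⟨γ', b', h'⟩ := h'
  have hc := hρ.continuous_levyExponent
  have hc' := hρ'.continuous_levyExponent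
  have hexp := eq_of_exp_eq
    (φ := fun z : ℝ => Complex.I * z * ((γ - ∫ x, trunc x ∂ρ : ℝ) : ℂ) -
      (1 / 2) * (z : ℂ) ^ 2 * b + levyExponent ρ z)
    (φ' := fun z : ℝ => Complex.I * z * ((γ' - ∫ x, trunc x ∂ρ' : ℝ) : ℂ) -
      (1 / 2) * (z : ℂ) ^ 2 * b' + levyExponent ρ' z)
    (by fun_prop) (by fun_prop) (by simp [levyExponent_zero]) (by simp [levyExponent_zero])
    (fun z => by rw [← h.charFun_eq hρ, ← h'.charFun_eq hρ'])
  let g : ℝ → ℝ → ℝ := fun w x => 2 - 2 * Real.cos (w * x)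
  have hg : ∀ w, Measurable (g w) := fun w => by fun_prop
  have hfin : ∀ ρ : Measure ℝ, IsLevyMeasureOne ρ → ∀ w,
      IsFiniteMeasure (ρ.withDensity fun x => ENNReal.ofReal (g w x)) := by
    intro ρ hρ w
    refine isFiniteMeasure_withDensity_of_le (C := ENNReal.ofReal (4 + 2 * |w|))
      ENNReal.ofReal_ne_top hρ.2.2 (.of_forall fun x => ?_)
    rw [← ENNReal.ofReal_mul (by positivity)]
    exact ENNReal.ofReal_le_ofReal (two_sub_two_cos_le w x)
  -- The Gaussian constant is the transform of an atom at `0`, which restriction removes because `ρ`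
  -- does not charge `0`.
  have hrestr : ∀ ρ : Measure ℝ, IsLevyMeasureOne ρ → ∀ w, ∀ c : ENNReal,
      ((ρ.withDensity fun x => ENNReal.ofReal (g w x)) + c • Measure.dirac 0).restrict {0}ᶜ =
        ρ.withDensity fun x => ENNReal.ofReal (g w x) := by
    intro ρ hρ w c
    rw [Measure.restrict_add, Measure.restrict_smul,
      Measure.restrict_eq_zero (μ := Measure.dirac 0) |>.2 (by simp), smul_zero, add_zero, Measure.restrict_eq_self_of_ae_mem]
    filter_upwards [withDensity_absolutelyContinuous _ _ hρ.ae_ne_zero] with x hx using hx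
  have hdens : ∀ w, (ρ.withDensity fun x => ENNReal.ofReal (g w x)) =
      ρ'.withDensity fun x => ENNReal.ofReal (g w x) := by
    intro w
    have := hfin ρ hρ w
    have := hfin ρ' hρ' w
    have hfd : ∀ c : ℝ, IsFiniteMeasure (ENNReal.ofReal c • (Measure.dirac 0 : Measure ℝ)) :=
      fun c => Measure.smul_finite _ ENNReal.ofReal_ne_top
    have := hfd (b * w ^ 2)
    have := hfd (b' * w ^ 2)
    rw [← hrestr ρ hρ w (ENNReal.ofReal (b * w ^ 2)),
      ← hrestr ρ' hρ' w (ENNReal.ofReal (b' * w ^ 2))]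
    congr 1
    refine Measure.ext_of_charFun (funext fun z => ?_)
    rw [charFun_add_smul_dirac (mul_nonneg h.1 (sq_nonneg w)),
      charFun_add_smul_dirac (mul_nonneg h'.1 (sq_nonneg w)),
      charFun_withDensity _ (hg w) fun x => two_sub_two_cos_nonneg _,
      charFun_withDensity _ (hg w) fun x => two_sub_two_cos_nonneg _,
      ← hρ.second_difference, ← hρ'.second_difference]
    have e0 := congrFun hexp z
    have e1 := congrFun hexp (z + w)
    have e2 := congrFun hexp (z - w)
    push_cast at e0 e1 e2 ⊢
    linear_combination 2 * e0 - e1 - e2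
  have hne : ∀ ρ : Measure ℝ, IsLevyMeasureOne ρ → ∀ᵐ x ∂ρ,
      ((fun x => ENNReal.ofReal (g 1 x)) + fun x => ENNReal.ofReal (g √2 x)) x ≠ 0 := by
    intro ρ hρ
    filter_upwards [hρ.ae_ne_zero] with x hx h0
    simp only [Pi.add_apply, add_eq_zero, ENNReal.ofReal_eq_zero, g] at h0
    refine hx (eq_zero_of_cos_eq_one (le_antisymm (Real.cos_le_one _) ?_)
      (le_antisymm (Real.cos_le_one _) ?_)) <;> linarith [h0.1, h0.2]
  refine eq_of_withDensity_eq (g := (fun x => ENNReal.ofReal (g 1 x)) +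
    fun x => ENNReal.ofReal (g √2 x)) (by fun_prop) (hne ρ hρ) (hne ρ' hρ') (by simp) ?_
  rw [withDensity_add_left (by fun_prop), withDensity_add_left (by fun_prop), hdens, hdens]

/-! ### Construction of subordinator laws. -/

/-- For a sub-probability density `h` relative to `ρ`, the missing mass is put at `0`. -/
theorem exists_charFun_eq_one_add_integral {ρ : Measure ℝ} (hneg : ρ (Iio 0) = 0) {h : ℝ → ℝ}
    (hm : Measurable h) (h0 : ∀ x, 0 ≤ h x) (hi : Integrable h ρ) (h1 : ∫ x, h x ∂ρ ≤ 1) :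
    ∃ ν : Measure ℝ, IsProbabilityMeasure ν ∧ ν (Iio 0) = 0 ∧
      ∀ z, charFun ν z = 1 + ∫ x, (h x : ℂ) * (Complex.exp (Complex.I * z * x) - 1) ∂ρ := by
  let σ := ρ.withDensity fun x => ENNReal.ofReal (h x)
  have hσ : σ univ = ENNReal.ofReal (∫ x, h x ∂ρ) := by
    rw [withDensity_apply _ MeasurableSet.univ, Measure.restrict_univ,
      ofReal_integral_eq_lintegral_ofReal hi (.of_forall h0)]
  have hσf : IsFiniteMeasure σ := ⟨by rw [hσ]; exact ENNReal.ofReal_lt_top⟩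
  have h1' : 0 ≤ 1 - ∫ x, h x ∂ρ := by linarith
  refine ⟨σ + ENNReal.ofReal (1 - ∫ x, h x ∂ρ) • Measure.dirac 0, ⟨?_⟩, ?_, fun z => ?_⟩
  · rw [Measure.add_apply, Measure.smul_apply, hσ, measure_univ, smul_eq_mul, mul_one,
      ← ENNReal.ofReal_add (integral_nonneg h0) h1']
    simp
  · rw [Measure.add_apply, withDensity_absolutelyContinuous _ _ hneg]
    simp
  · have hi' : Integrable (fun x => (h x : ℂ)) ρ := hi.ofReal
    have hie : Integrable (fun x => (h x : ℂ) * Complex.exp (z * x * Complex.I)) ρ := by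
      refine hi.mono' (by fun_prop) (.of_forall fun x => ?_)
      rw [norm_mul, ← Complex.ofReal_mul, Complex.norm_exp_ofReal_mul_I, Complex.norm_real,
        Real.norm_of_nonneg (h0 x), mul_one]
    rw [charFun_add_smul_dirac h1', charFun_withDensity _ hm h0]
    have : ∀ x : ℝ, (h x : ℂ) * (Complex.exp (Complex.I * z * x) - 1) =
        (h x : ℂ) * Complex.exp (z * x * Complex.I) - h x := fun x => by
      rw [mul_sub, mul_one]; congr 3; ring
    simp_rw [this]
    rw [integral_sub hie hi', integral_complex_ofReal]
    push_cast
    ring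

theorem IsLevyMeasureOne.exists_driftless {ρ : Measure ℝ} (hρ : IsLevyMeasureOne ρ) :
    ∃ P : Measure ℝ, IsProbabilityMeasure P ∧ P (Iio 0) = 0 ∧
      ∀ z, charFun P z = Complex.exp (levyExponent ρ z) := by
  set c := ∫ x, min 1 |x| ∂ρ with hc
  have hmin : ∀ x : ℝ, 0 ≤ min 1 |x| := fun x => le_min zero_le_one (abs_nonneg x)
  have hc0 : 0 ≤ c := integral_nonneg hmin
  -- The second bound keeps the total mass at most `1`; the first gives `n * h n x ≤ 1`, with
  -- equality eventually for `x ≠ 0`. The `n`-fold convolutions then converge by `(1 + a_n / n)^n →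
  -- exp a`.
  let h : ℕ → ℝ → ℝ := fun n x => min ((n : ℝ)⁻¹) ((c + 1)⁻¹ * min 1 |x|)
  have h0 : ∀ n x, 0 ≤ h n x := fun n x =>
    le_min (by positivity) (mul_nonneg (by positivity) (hmin x))
  have hm : ∀ n, Measurable (h n) := fun n => by fun_prop
  have hi : ∀ n, Integrable (h n) ρ := fun n =>
    (hρ.integrable.const_mul _).mono' (hm n).aestronglyMeasurable (.of_forall fun x => by
      rw [Real.norm_of_nonneg (h0 n x)]; exact min_le_right _ _)
  have h1 : ∀ n, ∫ x, h n x ∂ρ ≤ 1 := fun n => by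
    calc ∫ x, h n x ∂ρ ≤ ∫ x, (c + 1)⁻¹ * min 1 |x| ∂ρ :=
          integral_mono (hi n) (hρ.integrable.const_mul _) fun x => min_le_right _ _
      _ = (c + 1)⁻¹ * c := integral_const_mul _ _
      _ ≤ 1 := by rw [inv_mul_le_iff₀ (by positivity)]; linarith
  choose ν hν1 hν2 hν3 using fun n =>
    exists_charFun_eq_one_add_integral hρ.2.1 (hm n) (h0 n) (hi n) (h1 n)
  let μs : ℕ → ProbabilityMeasure ℝ :=
    fun n => ⟨convIter (ν n) n, isProbabilityMeasure_convIter _ _⟩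
  have hle : ∀ n x, n * h n x ≤ 1 := fun n x => by
    rcases n.eq_zero_or_pos with rfl | hn
    · simp
    · have hn' : (0 : ℝ) < n := by exact_mod_cast hn
      calc n * h n x ≤ n * (n : ℝ)⁻¹ := by gcongr; exact min_le_left _ _
        _ = 1 := mul_inv_cancel₀ hn'.ne'
  have hlim1 : ∀ x ≠ 0, ∀ᶠ n : ℕ in atTop, n * h n x = 1 := by
    intro x hx
    have hpos : 0 < (c + 1)⁻¹ * min 1 |x| :=
      mul_pos (by positivity) (lt_min zero_lt_one (abs_pos.2 hx))
    filter_upwards [(tendsto_inv_atTop_nhds_zero_nat (𝕜 := ℝ)).eventually (gt_mem_nhds hpos),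
      eventually_gt_atTop 0] with n hn hn0
    have hn' : (0 : ℝ) < n := by exact_mod_cast hn0
    simp only [h]
    rw [min_eq_left hn.le, mul_inv_cancel₀ hn'.ne']
  have hch : ∀ z, Tendsto (fun n => charFun (μs n : Measure ℝ) z) atTop
      (𝓝 (Complex.exp (levyExponent ρ z))) := by
    intro z
    have hpow : ∀ n, charFun (μs n : Measure ℝ) z =
        (1 + ∫ x, (h n x : ℂ) * (Complex.exp (Complex.I * z * x) - 1) ∂ρ) ^ n := fun n => by
      change charFun (convIter (ν n) n) z = _
      rw [charFun_convIter, hν3]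
    simp_rw [hpow]
    refine Complex.tendsto_one_add_pow_exp_of_tendsto ?_
    simp_rw [← integral_const_mul]
    refine tendsto_integral_of_dominated_convergence (fun x => (2 + |z|) * min 1 |x|)
      (fun n => by fun_prop) (hρ.integrable.const_mul _) (fun n => .of_forall fun x => ?_) ?_
    · rw [← mul_assoc, norm_mul]
      have : ‖(n : ℂ) * (h n x : ℂ)‖ ≤ 1 := by
        rw [← Complex.ofReal_natCast, ← Complex.ofReal_mul, Complex.norm_real,
          Real.norm_of_nonneg (mul_nonneg n.cast_nonneg (h0 n x))]
        exact hle n x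
      calc _ ≤ 1 * ‖Complex.exp (Complex.I * z * x) - 1‖ := by gcongr
        _ ≤ _ := by rw [one_mul]; exact norm_exp_sub_one_le z x
    · filter_upwards [hρ.ae_ne_zero] with x hx
      refine tendsto_const_nhds.congr' ?_
      filter_upwards [hlim1 x hx] with n hn
      rw [← mul_assoc, ← Complex.ofReal_natCast, ← Complex.ofReal_mul, hn, Complex.ofReal_one,
        one_mul]
  have hcont := hρ.continuous_levyExponent
  obtain ⟨P, hP1, hP2⟩ := exists_tendsto_of_tendsto_charFun
    (g := fun z => Complex.exp (levyExponent ρ z)) (by fun_prop) hch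
  exact ⟨P, inferInstance, measure_Iio_zero_of_tendsto hP2 fun n => convIter_Iio_zero (hν2 n) n,
    hP1⟩

theorem IsLevyMeasureOne.exists_subordinator_law {ρ : Measure ℝ} (hρ : IsLevyMeasureOne ρ)
    (d : ℝ) : ∃ P : Measure ℝ, IsProbabilityMeasure P ∧ P (Iio d) = 0 ∧
      ∀ z : ℝ, charFun P z = Complex.exp (Complex.I * z * d + levyExponent ρ z) := by
  obtain ⟨P, hP, h0, hch⟩ := hρ.exists_driftless
  refine ⟨P.map (· + d), Measure.isProbabilityMeasure_map (by fun_prop), ?_, fun z => ?_⟩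
  · rw [Measure.map_apply (by fun_prop) measurableSet_Iio]
    convert h0 using 2
    ext x; simp
  · rw [charFun_map_add_const, hch, ← Complex.exp_add]
    congr 1
    simp only [RCLike.inner_apply, conj_trivial, Complex.ofReal_mul]
    ring

theorem IsLevyMeasureOne.smul {ρ : Measure ℝ} (hρ : IsLevyMeasureOne ρ) {c : ENNReal}
    (hc : c ≠ ⊤) : IsLevyMeasureOne (c • ρ) := by
  refine ⟨⟨by simp [hρ.1.1], ?_⟩, by simp [hρ.2.1], ?_⟩
  · rw [lintegral_smul_measure]; exact ENNReal.mul_lt_top hc.lt_top hρ.1.2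
  · rw [lintegral_smul_measure]; exact ENNReal.mul_lt_top hc.lt_top hρ.2.2

/-- The `n`-th root has drift `d / n` and Lévy measure `ρ / n`. -/
theorem isInfDiv_of_charFun_eq {ρ P : Measure ℝ} (hρ : IsLevyMeasureOne ρ)
    [hP : IsProbabilityMeasure P] {d : ℝ}
    (h : ∀ z : ℝ, charFun P z = Complex.exp (Complex.I * z * d + levyExponent ρ z)) :
    IsInfDiv P := by
  refine ⟨hP, fun n hn => ?_⟩
  have hn' : (n : ℂ) ≠ 0 := by exact_mod_cast hn.ne'
  obtain ⟨ν, hν, -, hch⟩ := (hρ.smul (c := (n : ENNReal)⁻¹)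
    (by simp [hn.ne'])).exists_subordinator_law (d / n)
  have := isProbabilityMeasure_convIter ν n
  refine ⟨ν, hν, Measure.ext_of_charFun (funext fun z => ?_)⟩
  rw [charFun_convIter, hch, h, ← Complex.exp_nat_mul]
  congr 1
  simp only [levyExponent, integral_smul_measure, ENNReal.toReal_inv, ENNReal.toReal_natCast,
    Complex.real_smul]
  push_cast
  field_simp

/-- The law at time `1` of the subordinator with drift `d` and Lévy measure `ρ`. -/
theorem IsLevyMeasureOne.exists_isInfDivNonneg {ρ : Measure ℝ} (hρ : IsLevyMeasureOne ρ)
    {d : ℝ} (hd : 0 < d) : ∃ η : Measure ℝ, IsInfDivNonneg η ∧ HasLevyMeasure η ρ ∧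
      η (Iic 0) = 0 ∧
      ∀ z : ℝ, charFun η z = Complex.exp (Complex.I * z * d + levyExponent ρ z) := by
  obtain ⟨P, hP, h0, hch⟩ := hρ.exists_subordinator_law d
  -- Positive drift removes the atom that a compound Poisson law has at `0`.
  have h0' : P (Iic 0) = 0 := measure_mono_null (Iic_subset_Iio.2 hd) h0
  refine ⟨P, ⟨isInfDiv_of_charFun_eq hρ hch, measure_mono_null Iio_subset_Iic_self h0'⟩,
    ⟨d + ∫ x, trunc x ∂ρ, 0, le_rfl, hρ.1, fun z => ?_⟩, h0', hch⟩
  rw [hch, hρ.integral_triplet]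
  congr 1
  push_cast
  ring

/-! ### Matching pairs and conclusion. -/

theorem eq_of_restrict_Ioi_eq {P Q : Measure ℝ} [IsProbabilityMeasure P] [IsProbabilityMeasure Q]
    (hP : P (Iio 0) = 0) (hQ : Q (Iio 0) = 0) (h : P.restrict (Ioi 0) = Q.restrict (Ioi 0)) :
    P = Q := by
  refine Measure.ext_of_Iic P Q fun a => ?_
  rcases lt_or_ge a 0 with ha | ha
  · rw [measure_mono_null (Iic_subset_Iio.2 ha) hP, measure_mono_null (Iic_subset_Iio.2 ha) hQ]
  · have key : ∀ P : Measure ℝ, IsProbabilityMeasure P →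
        P (Iic a) = 1 - P.restrict (Ioi 0) (Ioi a) := fun P _ => by
      rw [Measure.restrict_apply measurableSet_Ioi, inter_eq_left.2 (Ioi_subset_Ioi ha),
        ← prob_compl_eq_one_sub measurableSet_Ioi, compl_Ioi]
    rw [key P inferInstance, key Q inferInstance, h]

theorem ne_of_drift_ne {P Q : Measure ℝ} {f : ℝ → ℂ}
    (hP : ∀ z : ℝ, charFun P z = Complex.exp (Complex.I * z * (1 : ℝ) + f z))
    (hQ : ∀ z : ℝ, charFun Q z = Complex.exp (Complex.I * z * (2 : ℝ) + f z)) : P ≠ Q := by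
  rintro rfl
  -- At `π` the drift factors are `-1` and `1`.
  have h := (hP Real.pi).symm.trans (hQ Real.pi)
  rw [Complex.exp_add, Complex.exp_add] at h
  have h2 := mul_right_cancel₀ (Complex.exp_ne_zero _) h
  have e1 : Complex.exp (Complex.I * Real.pi * (1 : ℝ)) = -1 := by
    rw [← Complex.exp_pi_mul_I]; congr 1; push_cast; ring
  have e2 : Complex.exp (Complex.I * Real.pi * (2 : ℝ)) = 1 := by
    rw [← Complex.exp_two_pi_mul_I]; congr 1; push_cast; ring
  rw [e1, e2] at h2
  norm_num at h2

theorem exists_pairs {μ ρ ρ' : Measure ℝ} (hρ : IsLevyMeasureOne ρ) (hρ' : IsLevyMeasureOne ρ')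
    (h : μ = Measure.dirac 0 ∨ ρ = ρ') :
    ∃ p ∈ matchingPairs μ ρ ρ', ∃ q ∈ matchingPairs μ ρ ρ',
      p.1 ≠ q.1 ∧ p.2 ≠ q.2 ∧
      p.1 (Iic 0) = 0 ∧ p.2 (Iic 0) = 0 ∧ q.1 (Iic 0) = 0 ∧ q.2 (Iic 0) = 0 := by
  have hpair : ∀ d > 0, ∃ p ∈ matchingPairs μ ρ ρ', p.1 (Iic 0) = 0 ∧ p.2 (Iic 0) = 0 ∧
      (∀ z : ℝ, charFun p.1 z = Complex.exp (Complex.I * z * (d : ℝ) + levyExponent ρ z)) ∧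
      ∀ z : ℝ, charFun p.2 z = Complex.exp (Complex.I * z * (d : ℝ) + levyExponent ρ' z) := by
    intro d hd
    obtain ⟨η, h1, h2, h3, h4⟩ := hρ.exists_isInfDivNonneg hd
    obtain ⟨η', h1', h2', h3', h4'⟩ := hρ'.exists_isInfDivNonneg hd
    refine ⟨(η, η'), ⟨h1, h1', h2, h2', ?_⟩, h3, h3', h4, h4'⟩
    rcases h with rfl | rfl
    · rw [levyMix_dirac_zero, levyMix_dirac_zero]
    · have := h1.1.1
      have := h1'.1.1
      rw [show η = η' from Measure.ext_of_charFun (funext fun z => by rw [h4, h4'])]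
  obtain ⟨p, hp, hp1, hp2, hp3, hp4⟩ := hpair 1 one_pos
  obtain ⟨q, hq, hq1, hq2, hq3, hq4⟩ := hpair 2 two_pos
  exact ⟨p, hp, q, hq, ne_of_drift_ne hp3 hq3, ne_of_drift_ne hp4 hq4, hp1, hp2, hq1, hq2⟩

theorem lintegral_min_one_abs_lt_top (η : Measure ℝ) [IsProbabilityMeasure η] :
    ∫⁻ x, ENNReal.ofReal (min 1 |x|) ∂η < ⊤ := by
  refine lt_of_le_of_lt (lintegral_mono (g := fun _ => 1) fun x => ?_) (by simp)
  simp

theorem mainTheorem12 (μ ρ ρ' : Measure ℝ) (hμ : IsInfDiv μ)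
    (hsupp : μ.map (fun x => -x) = μ ∨ μ (Iio 0) = 0)
    (hρ : IsLevyMeasureOne ρ) (hρ' : IsLevyMeasureOne ρ') :
    (levyMix μ ρ = levyMix μ ρ' ↔
      ∃ η η' : Measure ℝ, IsInfDivNonneg η ∧ IsInfDivNonneg η' ∧
        HasLevyMeasure η ρ ∧ HasLevyMeasure η' ρ' ∧ levyMix μ η = levyMix μ η') ∧
    (levyMix μ ρ = levyMix μ ρ' →
      ∃ p ∈ matchingPairs μ ρ ρ', ∃ q ∈ matchingPairs μ ρ ρ',
        p.1 ≠ q.1 ∧ p.2 ≠ q.2 ∧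
        p.1 (Iic 0) = 0 ∧ p.2 (Iic 0) = 0 ∧ q.1 (Iic 0) = 0 ∧ q.2 (Iic 0) = 0) := by
  -- For `μ` the point mass at `0`, the mixtures agree for unrelated `ρ` and `ρ'`, so this case
  -- stays separate.
  have hforward : levyMix μ ρ = levyMix μ ρ' → μ = Measure.dirac 0 ∨ ρ = ρ' := by
    intro h
    by_cases hne : μ = Measure.dirac 0
    · exact .inl hne
    have hpos : ∀ ρ : Measure ℝ, IsLevyMeasureOne ρ → ρ.restrict (Ioi 0) = ρ := by
      intro ρ hρ
      refine Measure.restrict_eq_self_of_ae_mem ?_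
      filter_upwards [ae_nonneg_of_measure_Iio hρ.2.1, hρ.ae_ne_zero] with x h1 h2
      exact lt_of_le_of_ne h1 h2.symm
    rw [← hpos ρ hρ, ← hpos ρ' hρ']
    exact .inr (hμ.restrict_eq_of_levyMix_eq hsupp hne hρ.2.2 hρ'.2.2 h)
  refine ⟨⟨fun h => ?_, ?_⟩, fun h => exists_pairs hρ hρ' (hforward h)⟩
  · obtain ⟨p, ⟨h1, h2, h3, h4, h5⟩, -⟩ := exists_pairs hρ hρ' (hforward h)
    exact ⟨p.1, p.2, h1, h2, h3, h4, h5⟩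
  · rintro ⟨η, η', hη, hη', hL, hL', h⟩
    by_cases hne : μ = Measure.dirac 0
    · rw [hne, levyMix_dirac_zero, levyMix_dirac_zero]
    have := hη.1.1
    have := hη'.1.1
    have heq : η = η' := eq_of_restrict_Ioi_eq hη.2 hη'.2
      (hμ.restrict_eq_of_levyMix_eq hsupp hne (lintegral_min_one_abs_lt_top η)
        (lintegral_min_one_abs_lt_top η') h)
    rw [hL.unique (heq ▸ hL') hρ hρ']
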